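/- **Theorem.** Let $\mathbf{B}$ be a category with finite coproducts $(+,0)$ and a final object $1$. Then $\mathbf{B}$ is extensive if and only if it is a Boolean effectus with comprehension. Moreover, if $\mathbf{B}$ is extensive (equivalently, a Boolean effectus with comprehension), then it has quotients. Here the notions are as follows. Write $\kappa_1,\kappa_2$ for coprojections and $!$ for maps to $1$. *Extensive.* $\mathbf{B}$ is extensive if pullbacks along coprojections exist and in every commutative diagram with top row $Z_1\to Z\leftarrow Z_2$, bottom row $X\xrightarrow{\kappa_1}X+Y\xleftarrow{\kappa_2}Y$ and vertical maps $Z_1\to X$, $Z\to X+Y$, $Z_2\to Y$, both squares are pullbacks if and only if the top row is a coproduct. *Effectus.* $\mathbf{B}$ is an effectus if, for all $X,Y$, (i) $X+Y$ with $\mathrm{id}+{!}\colon X+Y\to X+1$ and ${!}+\mathrm{id}\colon X+Y\to 1+Y$ is a pullback of ${!}+\mathrm{id}\colon X+1\to 1+1$ and $\mathrm{id}+{!}\colon 1+Y\to 1+1$; (ii) $X$ with $!\colon X\to 1$ and $\kappa_1\colon X\to X+Y$ is a pullback of $\kappa_1\colon 1\to 1+1$ and ${!}+{!}\colon X+Y\to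 1+1$; and (iii) the two maps $[[\kappa_1,\kappa_2],\kappa_2],\,[[\kappa_2,\kappa_1],\kappa_2]\colon (1+1)+1\to 1+1$ are jointly monic. *Partial maps and predicates.* A partial map $X\rightharpoonup Y$ is a map $X\to Y+1$; the composite of $f\colon X\rightharpoonup Y$ and $g\colon Y\rightharpoonup Z$ is $g\bullet f=[g,\kappa_2]\circ f$, the identity is $\kappa_1$, and the zero partial map is $\mathbf{0}=\kappa_2\circ{!}$; these form a category $\mathrm{Par}(\mathbf{B})$. A predicate on $X$ is a map $p\colon X\to 1+1$, with $\mathbf{1}=\kappa_1\circ{!}$, $\mathbf{0}=\kappa_2\circ{!}$ and $p^\bot=[\kappa_2,\kappa_1]\circ p$. For $f,g\colon X\rightharpoonup Y$ the sum $f\ovee g$ is defined if there is $b\colon X\to (Y+Y)+1$ with $[\mathrm{id}+{!},\kappa_2]\circ b=f$ and $[[\kappa_2\circ{!},\kappa_1],\kappa_2]\circ b=g$, and then $f\ovee g=(\nabla+\mathrm{id})\circ b$. Write $f\le g$ if $f\ovee h=g$ for some $h$. *Boolean effectus.* An effectus is commutative if for each $X$ the map $f\mapsto({!}+\mathrm{id})\circ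 f$, from the set of partial maps $f\colon X\rightharpoonup X$ with $f\le\mathrm{id}$ to the set of predicates on $X$, is bijective, and its inverse $p\mapsto\mathrm{asrt}_p$ satisfies $\mathrm{asrt}_p\bullet\mathrm{asrt}_q=\mathrm{asrt}_q\bullet\mathrm{asrt}_p$ for all $p,q$. It is Boolean if in addition $\mathrm{asrt}_p\bullet\mathrm{asrt}_{p^\bot}=\mathbf{0}$ for all $p$. *Comprehension.* Let $\mathrm{Pred}(\mathbf{B})$ have as objects the pairs $(X,p)$ with $p$ a predicate on $X$, and as morphisms $(X,p)\to(Y,q)$ the maps $f\colon X\to Y$ with $p\le q\circ f$. The effectus $\mathbf{B}$ has comprehension if the functor $X\mapsto(X,\mathbf{1})$ from $\mathbf{B}$ to $\mathrm{Pred}(\mathbf{B})$ has a right adjoint $(X,p)\mapsto\{X|p\}$, with counit $\pi_p\colon\{X|p\}\to X$, such that for all $p$ on $X$ and all $Y$ the canonical map $\{X|p\}+Y\to\{X+Y\,|\,[p,\mathbf{1}]\}$ induced by $\pi_p+\mathrm{id}$ is an isomorphism. *Quotients.* Let $\mathrm{Pred}_\Box(\mathrm{Par}(\mathbf{B}))$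 have the same objects $(X,p)$, and as morphisms $(X,p)\to(Y,q)$ the partial maps $f\colon X\rightharpoonup Y$ with $p\le[q,\kappa_1]\circ f$. The effectus $\mathbf{B}$ has quotients if the functor $X\mapsto(X,\mathbf{0})$ from $\mathrm{Par}(\mathbf{B})$ to $\mathrm{Pred}_\Box(\mathrm{Par}(\mathbf{B}))$ has a left adjoint. -/

import Mathlib

open CategoryTheory CategoryTheory.Limits

universe v u

namespace EffectusTheory

set_option linter.unusedSimpArgs false

noncomputable section

variable {C : Type u} [Category.{v} C] [HasFiniteCoproducts C] [HasTerminal C]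

/-! ### Partial maps and predicates -/

/-- A partial map from `X` to `Y` is a map `X ⟶ Y + 1`. -/
abbrev PHom (X Y : C) : Type v := X ⟶ Y ⨿ ⊤_ C

/-- A predicate on `X` is a map `X ⟶ 1 + 1`, that is, a partial map from `X` to `1`. -/
abbrev Pred (X : C) : Type v := PHom X (⊤_ C)

/-- The identity partial map. -/
def pid (X : C) : PHom X X := coprod.inl

/-- Composition of partial maps, in diagrammatic order: first `f`, then `g`. -/
def pcomp {X Y Z : C} (f : PHom X Y) (g : PHom Y Z) : PHom X Z :=
  f ≫ coprod.desc g coprod.inr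

/-- The zero (nowhere defined) partial map. -/
def pzero (X Y : C) : PHom X Y := terminal.from X ≫ coprod.inr

/-- The first partial projection `X + Y ⟶ X + 1`. -/
def projOne (X Y : C) : PHom (X ⨿ Y) X := coprod.map (𝟙 X) (terminal.from Y)

/-- The second partial projection `X + Y ⟶ Y + 1`. -/
def projTwo (X Y : C) : PHom (X ⨿ Y) Y :=
  coprod.desc (terminal.from X ≫ coprod.inr) coprod.inl

/-- `b` is a bound for the parallel partial maps `f` and `g`. -/
def IsBound {X Y : C} (f g : PHom X Y) (b : PHom X (Y ⨿ Y)) : Prop :=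
  pcomp b (projOne Y Y) = f ∧ pcomp b (projTwo Y Y) = g

/-- The partial sum of `f` and `g` is defined and equal to `h`: there is a bound `b` for `f` and
`g` whose composite with the codiagonal is `h`. In an effectus `b` is unique. -/
def IsSum {X Y : C} (f g h : PHom X Y) : Prop :=
  ∃ b : PHom X (Y ⨿ Y), IsBound f g b ∧ b ≫ coprod.map (codiag Y) (𝟙 (⊤_ C)) = h

/-- The order on parallel partial maps, and on predicates in particular. -/
def PLe {X Y : C} (f g : PHom X Y) : Prop := ∃ h : PHom X Y, IsSum f h g

/-- The true predicate. -/
def truth (X : C) : Pred X := terminal.from X ≫ coprod.inl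

/-- The false predicate. -/
def falsity (X : C) : Pred X := terminal.from X ≫ coprod.inr

/-- The orthosupplement of a predicate, which swaps the two outcomes. -/
def ortho {X : C} (p : Pred X) : Pred X := p ≫ coprod.desc coprod.inr coprod.inl

/-- The partial substitution `[q, κ₁] ∘ f` of a predicate along a partial map. -/
def box {X Y : C} (f : PHom X Y) (q : Pred Y) : Pred X := f ≫ coprod.desc q coprod.inl

/-- The kernel-supplement `(! + id) ∘ f` of a partial map: its domain predicate. -/
def kerSupp {X Y : C} (f : PHom X Y) : Pred X :=
  f ≫ coprod.map (terminal.from Y) (𝟙 (⊤_ C))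

/-! ### Effectuses -/

/-- The map `[[κ₁, κ₂], κ₂] : (1 + 1) + 1 ⟶ 1 + 1`. -/
def mapIV (C : Type u) [Category.{v} C] [HasFiniteCoproducts C] [HasTerminal C] :
    ((⊤_ C) ⨿ (⊤_ C)) ⨿ (⊤_ C) ⟶ (⊤_ C) ⨿ (⊤_ C) :=
  coprod.desc (coprod.desc coprod.inl coprod.inr) coprod.inr

/-- The map `[[κ₂, κ₁], κ₂] : (1 + 1) + 1 ⟶ 1 + 1`. -/
def mapXI (C : Type u) [Category.{v} C] [HasFiniteCoproducts C] [HasTerminal C] :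
    ((⊤_ C) ⨿ (⊤_ C)) ⨿ (⊤_ C) ⟶ (⊤_ C) ⨿ (⊤_ C) :=
  coprod.desc (coprod.desc coprod.inr coprod.inl) coprod.inr

/-- A category with finite coproducts and a final object is an effectus (in total form). -/
class Effectus (C : Type u) [Category.{v} C] [HasFiniteCoproducts C] [HasTerminal C] : Prop where
  isPullback_map : ∀ X Y : C, IsPullback
    (coprod.map (𝟙 X) (terminal.from Y)) (coprod.map (terminal.from X) (𝟙 Y))
    (coprod.map (terminal.from X) (𝟙 (⊤_ C))) (coprod.map (𝟙 (⊤_ C)) (terminal.from Y))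
  isPullback_inl : ∀ X Y : C, IsPullback
    (terminal.from X) (coprod.inl : X ⟶ X ⨿ Y)
    (coprod.inl : (⊤_ C) ⟶ (⊤_ C) ⨿ (⊤_ C)) (coprod.map (terminal.from X) (terminal.from Y))
  jointly_monic : ∀ {X : C} (f g : X ⟶ ((⊤_ C) ⨿ (⊤_ C)) ⨿ (⊤_ C)),
    f ≫ mapIV C = g ≫ mapIV C → f ≫ mapXI C = g ≫ mapXI C → f = g

/-! ### Commutative and Boolean effectuses -/

/-- The side-effect free partial endomaps: those below the identity. -/
def EndLe (X : C) : Type v := {f : PHom X X // PLe f (pid X)}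

/-- The kernel-supplement, from side-effect free endomaps to predicates. -/
def kerSuppEnd (X : C) (f : EndLe X) : Pred X := kerSupp f.1

/-- The assert map of a predicate: the inverse of `kerSuppEnd` when that map is bijective. -/
def asrt {X : C} (h : Function.Bijective (kerSuppEnd X)) (p : Pred X) : PHom X X :=
  ((Equiv.ofBijective (kerSuppEnd X) h).symm p).1

/-- A commutative effectus. -/
class CommutativeEffectus (C : Type u) [Category.{v} C] [HasFiniteCoproducts C]
    [HasTerminal C] : Prop extends Effectus C where
  bijective_kerSupp : ∀ X : C, Function.Bijective (kerSuppEnd X)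
  asrt_comm : ∀ (X : C) (p q : Pred X),
    pcomp (asrt (bijective_kerSupp X) q) (asrt (bijective_kerSupp X) p) =
      pcomp (asrt (bijective_kerSupp X) p) (asrt (bijective_kerSupp X) q)

/-- A Boolean effectus. -/
class BooleanEffectus (C : Type u) [Category.{v} C] [HasFiniteCoproducts C]
    [HasTerminal C] : Prop extends CommutativeEffectus C where
  asrt_ortho : ∀ (X : C) (p : Pred X),
    pcomp (asrt (bijective_kerSupp X) (ortho p)) (asrt (bijective_kerSupp X) p) = pzero X X

/-! ### Basic facts about the order on predicates -/

/-- For predicates, sums can be described by maps into `(1 + 1) + 1`. -/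
theorem isSum_pred_iff {X : C} (p q r : Pred X) :
    IsSum p q r ↔ ∃ b : X ⟶ ((⊤_ C) ⨿ (⊤_ C)) ⨿ (⊤_ C), b ≫ mapIV C = p ∧ b ≫ mapXI C = q ∧
      b ≫ coprod.desc (codiag (⊤_ C) ≫ coprod.inl) coprod.inr = r := by
  have h1 : coprod.desc (projOne (⊤_ C) (⊤_ C)) coprod.inr = mapIV C := by
    have : terminal.from (⊤_ C) = 𝟙 _ := Subsingleton.elim _ _
    ext <;> simp [projOne, mapIV, this, -coprod.desc_comp, coprod.inl_desc,
      coprod.inr_desc, coprod.inl_desc_assoc, coprod.inr_desc_assoc]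
  have h2 : coprod.desc (projTwo (⊤_ C) (⊤_ C)) coprod.inr = mapXI C := by
    have : terminal.from (⊤_ C) = 𝟙 _ := Subsingleton.elim _ _
    ext <;> simp [projTwo, mapXI, this, -coprod.desc_comp, coprod.inl_desc,
      coprod.inr_desc, coprod.inl_desc_assoc, coprod.inr_desc_assoc]
  have h3 : coprod.map (codiag (⊤_ C)) (𝟙 (⊤_ C)) =
      coprod.desc (codiag (⊤_ C) ≫ coprod.inl) coprod.inr := by
    ext <;> simp [-coprod.desc_comp, coprod.inl_desc,
      coprod.inr_desc, coprod.inl_desc_assoc, coprod.inr_desc_assoc]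
  simp only [IsSum, IsBound, pcomp, h1, h2, h3, and_assoc]

theorem pLe_refl {X : C} (p : Pred X) : PLe p p := by
  refine ⟨falsity X, (isSum_pred_iff _ _ _).2
    ⟨p ≫ coprod.desc (coprod.inl ≫ coprod.inl) coprod.inr, ?_, ?_, ?_⟩⟩
  · have : coprod.desc (coprod.inl ≫ coprod.inl) coprod.inr ≫ mapIV C = 𝟙 _ := by
      ext <;> simp [mapIV, -coprod.desc_comp, coprod.inl_desc,
      coprod.inr_desc, coprod.inl_desc_assoc, coprod.inr_desc_assoc]
    rw [Category.assoc, this, Category.comp_id]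
  · have : coprod.desc (coprod.inl ≫ coprod.inl) coprod.inr ≫ mapXI C =
        terminal.from _ ≫ coprod.inr := by
      ext
      · simp only [mapXI, coprod.inl_desc_assoc, Category.assoc, coprod.inl_desc]
        rw [← Category.assoc, Subsingleton.elim (coprod.inl ≫ terminal.from _) (𝟙 (⊤_ C)),
          Category.id_comp]
      · simp only [mapXI, coprod.inr_desc_assoc, coprod.inr_desc]
        rw [← Category.assoc, Subsingleton.elim (coprod.inr ≫ terminal.from _) (𝟙 (⊤_ C)),
          Category.id_comp]
    rw [Category.assoc, this, ← Category.assoc, falsity]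
    congr 1
    exact Subsingleton.elim _ _
  · have : (coprod.desc (coprod.inl ≫ coprod.inl) coprod.inr :
        (⊤_ C) ⨿ (⊤_ C) ⟶ ((⊤_ C) ⨿ (⊤_ C)) ⨿ (⊤_ C)) ≫
        coprod.desc (codiag (⊤_ C) ≫ coprod.inl) coprod.inr = 𝟙 _ := by
      ext <;> simp [-coprod.desc_comp, coprod.inl_desc,
      coprod.inr_desc, coprod.inl_desc_assoc, coprod.inr_desc_assoc]
    rw [Category.assoc, this, Category.comp_id]

theorem falsity_pLe {X : C} (p : Pred X) : PLe (falsity X) p := by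
  refine ⟨p, (isSum_pred_iff _ _ _).2
    ⟨p ≫ coprod.desc (coprod.inr ≫ coprod.inl) coprod.inr, ?_, ?_, ?_⟩⟩
  · have : coprod.desc (coprod.inr ≫ coprod.inl) coprod.inr ≫ mapIV C =
        terminal.from _ ≫ coprod.inr := by
      ext
      · simp only [mapIV, coprod.inl_desc_assoc, Category.assoc, coprod.inl_desc,
          coprod.inr_desc]
        rw [← Category.assoc, Subsingleton.elim (coprod.inl ≫ terminal.from _) (𝟙 (⊤_ C)),
          Category.id_comp]
      · simp only [mapIV, coprod.inr_desc_assoc, coprod.inr_desc]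
        rw [← Category.assoc, Subsingleton.elim (coprod.inr ≫ terminal.from _) (𝟙 (⊤_ C)),
          Category.id_comp]
    rw [Category.assoc, this, ← Category.assoc, falsity]
    congr 1
    exact Subsingleton.elim _ _
  · have : coprod.desc (coprod.inr ≫ coprod.inl) coprod.inr ≫ mapXI C = 𝟙 _ := by
      ext <;> simp [mapXI, -coprod.desc_comp, coprod.inl_desc,
      coprod.inr_desc, coprod.inl_desc_assoc, coprod.inr_desc_assoc]
    rw [Category.assoc, this, Category.comp_id]
  · have : (coprod.desc (coprod.inr ≫ coprod.inl) coprod.inr :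
        (⊤_ C) ⨿ (⊤_ C) ⟶ ((⊤_ C) ⨿ (⊤_ C)) ⨿ (⊤_ C)) ≫
        coprod.desc (codiag (⊤_ C) ≫ coprod.inl) coprod.inr = 𝟙 _ := by
      ext <;> simp [-coprod.desc_comp, coprod.inl_desc,
      coprod.inr_desc, coprod.inl_desc_assoc, coprod.inr_desc_assoc]
    rw [Category.assoc, this, Category.comp_id]

theorem pLe_trans [Effectus C] {X : C} {p q r : Pred X} (h₁ : PLe p q) (h₂ : PLe q r) :
    PLe p r := by
  obtain ⟨s, hs⟩ := h₁
  obtain ⟨t, ht⟩ := h₂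
  obtain ⟨a, ha1, -, ha3⟩ := (isSum_pred_iff _ _ _).1 hs
  obtain ⟨b, hb1, -, hb3⟩ := (isSum_pred_iff _ _ _).1 ht
  have htT : ∀ f : (⊤_ C) ⨿ (⊤_ C) ⟶ (⊤_ C), f = codiag (⊤_ C) := fun f => Subsingleton.elim _ _
  have hp := Effectus.isPullback_map ((⊤_ C) ⨿ (⊤_ C)) ((⊤_ C) ⨿ (⊤_ C))
  let b' := b ≫ (coprod.associator (⊤_ C) (⊤_ C) (⊤_ C)).hom
  have hw : a ≫ coprod.map (terminal.from ((⊤_ C) ⨿ (⊤_ C))) (𝟙 (⊤_ C)) =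
      b' ≫ coprod.map (𝟙 (⊤_ C)) (terminal.from ((⊤_ C) ⨿ (⊤_ C))) := by
    have e1 : coprod.map (terminal.from ((⊤_ C) ⨿ (⊤_ C))) (𝟙 (⊤_ C)) =
        coprod.desc (codiag (⊤_ C) ≫ coprod.inl) coprod.inr := by
      rw [htT (terminal.from ((⊤_ C) ⨿ (⊤_ C)))]; ext <;> simp [-coprod.desc_comp, coprod.inl_desc,
      coprod.inr_desc, coprod.inl_desc_assoc, coprod.inr_desc_assoc]
    have e2 : (coprod.associator (⊤_ C) (⊤_ C) (⊤_ C)).hom ≫ coprod.map (𝟙 (⊤_ C)) (terminal.from ((⊤_ C) ⨿ (⊤_ C))) =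
        mapIV C := by
      rw [htT (terminal.from ((⊤_ C) ⨿ (⊤_ C)))]; ext <;> simp [mapIV, -coprod.desc_comp, coprod.inl_desc,
      coprod.inr_desc, coprod.inl_desc_assoc, coprod.inr_desc_assoc]
    rw [e1, ha3, Category.assoc, e2, hb1]
  let c := hp.lift a b' hw
  have hc1 : c ≫ coprod.map (𝟙 _) (terminal.from ((⊤_ C) ⨿ (⊤_ C))) = a := hp.lift_fst _ _ _
  have hc2 : c ≫ coprod.map (terminal.from ((⊤_ C) ⨿ (⊤_ C))) (𝟙 _) = b' := hp.lift_snd _ _ _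
  let m : ((⊤_ C) ⨿ (⊤_ C)) ⨿ ((⊤_ C) ⨿ (⊤_ C)) ⟶ ((⊤_ C) ⨿ (⊤_ C)) ⨿ (⊤_ C) :=
    coprod.desc coprod.inl (coprod.desc (coprod.inr ≫ coprod.inl) coprod.inr)
  refine ⟨(c ≫ m) ≫ mapXI C, (isSum_pred_iff _ _ _).2 ⟨c ≫ m, ?_, rfl, ?_⟩⟩
  · have e : m ≫ mapIV C = coprod.map (𝟙 _) (terminal.from ((⊤_ C) ⨿ (⊤_ C))) ≫ mapIV C := by
      rw [htT (terminal.from ((⊤_ C) ⨿ (⊤_ C)))]; ext <;> simp [m, mapIV, -coprod.desc_comp, coprod.inl_desc,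
      coprod.inr_desc, coprod.inl_desc_assoc, coprod.inr_desc_assoc]
    rw [Category.assoc, e, ← Category.assoc, hc1, ha1]
  · have e : m ≫ coprod.desc (codiag (⊤_ C) ≫ coprod.inl) coprod.inr =
        coprod.map (terminal.from ((⊤_ C) ⨿ (⊤_ C))) (𝟙 _) ≫ coprod.desc coprod.inl (𝟙 ((⊤_ C) ⨿ (⊤_ C))) := by
      rw [htT (terminal.from ((⊤_ C) ⨿ (⊤_ C)))]; ext <;> simp [m, -coprod.desc_comp, coprod.inl_desc,
      coprod.inr_desc, coprod.inl_desc_assoc, coprod.inr_desc_assoc]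
    have e' : (coprod.associator (⊤_ C) (⊤_ C) (⊤_ C)).hom ≫ coprod.desc coprod.inl (𝟙 ((⊤_ C) ⨿ (⊤_ C))) =
        coprod.desc (codiag (⊤_ C) ≫ coprod.inl) coprod.inr := by
      ext <;> simp [-coprod.desc_comp, coprod.inl_desc,
      coprod.inr_desc, coprod.inl_desc_assoc, coprod.inr_desc_assoc]
    rw [Category.assoc, e, ← Category.assoc, hc2, Category.assoc, e', hb3]

theorem pLe_precomp {X Y : C} (f : X ⟶ Y) {p q : Pred Y} (h : PLe p q) :
    PLe (f ≫ p) (f ≫ q) := by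
  obtain ⟨s, hs⟩ := h
  obtain ⟨b, h1, h2, h3⟩ := (isSum_pred_iff _ _ _).1 hs
  exact ⟨f ≫ s, (isSum_pred_iff _ _ _).2 ⟨f ≫ b, by simp [h1], by simp [h2],
    by rw [Category.assoc, h3]⟩⟩

theorem pLe_desc {X Y : C} {p q : Pred X} {p' q' : Pred Y} (h : PLe p q) (h' : PLe p' q') :
    PLe (coprod.desc p p') (coprod.desc q q') := by
  obtain ⟨s, hs⟩ := h
  obtain ⟨s', hs'⟩ := h'
  obtain ⟨b, h1, h2, h3⟩ := (isSum_pred_iff _ _ _).1 hs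
  obtain ⟨b', h1', h2', h3'⟩ := (isSum_pred_iff _ _ _).1 hs'
  exact ⟨coprod.desc s s', (isSum_pred_iff _ _ _).2 ⟨coprod.desc b b', by rw [coprod.desc_comp, h1, h1'],
    by rw [coprod.desc_comp, h2, h2'], by rw [coprod.desc_comp, h3, h3']⟩⟩

theorem box_mono {X Y : C} (f : PHom X Y) {p q : Pred Y} (h : PLe p q) :
    PLe (box f p) (box f q) :=
  pLe_precomp f (pLe_desc h (pLe_refl _))

theorem comp_truth {X Y : C} (f : X ⟶ Y) : f ≫ truth Y = truth X := by
  rw [truth, truth, ← Category.assoc]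
  congr 1
  exact Subsingleton.elim _ _

theorem desc_truth (X Y : C) : coprod.desc (truth X) (truth Y) = truth (X ⨿ Y) := by
  ext <;> simp [comp_truth, coprod.inl_desc, coprod.inr_desc]

/-! ### The category of predicates, and comprehension -/

/-- Objects of the category of predicates of an effectus in total form. -/
structure PredCat (C : Type u) [Category.{v} C] [HasFiniteCoproducts C] [HasTerminal C] where
  carrier : C
  pred : Pred carrier

/-- A morphism `(X, p) ⟶ (Y, q)` is a (total) map `f : X ⟶ Y` with `p ≤ q ∘ f`. -/
@[ext]
structure PredCat.Hom (A B : PredCat C) where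
  map : A.carrier ⟶ B.carrier
  le : PLe A.pred (map ≫ B.pred)

instance [Effectus C] : Category.{v} (PredCat C) where
  Hom := PredCat.Hom
  id A := ⟨𝟙 _, by simpa using pLe_refl A.pred⟩
  comp f g := ⟨f.map ≫ g.map, by
    simpa using pLe_trans f.le (pLe_precomp f.map g.le)⟩
  id_comp f := PredCat.Hom.ext (Category.id_comp f.map)
  comp_id f := PredCat.Hom.ext (Category.comp_id f.map)
  assoc f g h := PredCat.Hom.ext (Category.assoc f.map g.map h.map)

/-- The truth functor of an effectus in total form. -/
def truthFunctor (C : Type u) [Category.{v} C] [HasFiniteCoproducts C] [HasTerminal C]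
    [Effectus C] : C ⥤ PredCat C where
  obj X := ⟨X, truth X⟩
  map {X Y} f := PredCat.Hom.mk (A := ⟨X, truth X⟩) (B := ⟨Y, truth Y⟩) f
    (by simpa [comp_truth] using pLe_refl (truth X))

section Comprehension

variable [Effectus C] {G : PredCat C ⥤ C}

/-- The comprehension map `π_p : {X | p} ⟶ X`, underlying the counit. -/
def cmprMap (adj : truthFunctor C ⊣ G) (A : PredCat C) : G.obj A ⟶ A.carrier :=
  PredCat.Hom.map (adj.counit.app A)

/-- The map `π_p + id : ({X | p} + Y, 1) ⟶ (X + Y, [p, 1])` in the category of predicates. -/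
def cmprSumHom (adj : truthFunctor C ⊣ G) {X : C} (p : Pred X) (Y : C) :
    (truthFunctor C).obj (G.obj ⟨X, p⟩ ⨿ Y) ⟶
      (⟨X ⨿ Y, coprod.desc p (truth Y)⟩ : PredCat C) :=
  PredCat.Hom.mk (A := (truthFunctor C).obj (G.obj ⟨X, p⟩ ⨿ Y))
    (B := ⟨X ⨿ Y, coprod.desc p (truth Y)⟩)
    (coprod.map (cmprMap adj ⟨X, p⟩) (𝟙 Y)) (by
      have h : PLe (truth (G.obj ⟨X, p⟩)) (cmprMap adj ⟨X, p⟩ ≫ p) :=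
        PredCat.Hom.le (adj.counit.app ⟨X, p⟩)
      have h' := pLe_desc h (pLe_refl (truth Y))
      rw [desc_truth] at h'
      simpa [truthFunctor] using h')

/-- The canonical map `{X | p} + Y ⟶ {X + Y | [p, 1]}`, the adjoint transpose of `π_p + id`. -/
def cmprCanonical (adj : truthFunctor C ⊣ G) {X : C} (p : Pred X) (Y : C) :
    G.obj ⟨X, p⟩ ⨿ Y ⟶ G.obj ⟨X ⨿ Y, coprod.desc p (truth Y)⟩ :=
  adj.homEquiv _ _ (cmprSumHom adj p Y)

/-- An effectus in total form has comprehension: the truth functor has a right adjoint, and the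
canonical maps `{X | p} + Y ⟶ {X + Y | [p, 1]}` are isomorphisms. -/
def HasComprehension (C : Type u) [Category.{v} C] [HasFiniteCoproducts C] [HasTerminal C]
    [Effectus C] : Prop :=
  ∃ (G : PredCat C ⥤ C) (adj : truthFunctor C ⊣ G),
    ∀ (X : C) (p : Pred X) (Y : C), IsIso (cmprCanonical adj p Y)

end Comprehension

/-! ### The category of partial maps, its category of predicates, and quotients -/

/-- Objects of the category of partial maps. -/
structure Par (C : Type u) where
  of : C

/-- A morphism of `Par C` is a partial map. -/
@[ext]
structure Par.Hom (X Y : Par C) where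
  map : PHom X.of Y.of

instance : Category.{v} (Par C) where
  Hom := Par.Hom
  id X := ⟨pid X.of⟩
  comp f g := ⟨pcomp f.map g.map⟩
  id_comp f := Par.Hom.ext (by simp [pcomp, pid, coprod.inl_desc])
  comp_id f := Par.Hom.ext (by simp [pcomp, pid, coprod.inl_desc])
  assoc f g h := Par.Hom.ext (by simp [pcomp, coprod.inr_desc])

/-- Objects of the category of predicates of the category of partial maps. -/
structure PredBox (C : Type u) [Category.{v} C] [HasFiniteCoproducts C] [HasTerminal C] where
  carrier : C
  pred : Pred carrier

/-- A morphism `(X, p) ⟶ (Y, q)` is a partial map `f` from `X` to `Y` with `p ≤ box f q`. -/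
@[ext]
structure PredBox.Hom (A B : PredBox C) where
  map : PHom A.carrier B.carrier
  le : PLe A.pred (box map B.pred)

theorem box_pid {X : C} (p : Pred X) : box (pid X) p = p := by
  simp [box, pid, coprod.inl_desc]

theorem box_pcomp {X Y Z : C} (f : PHom X Y) (g : PHom Y Z) (p : Pred Z) :
    box (pcomp f g) p = box f (box g p) := by
  simp [box, pcomp, coprod.inr_desc]

instance [Effectus C] : Category.{v} (PredBox C) where
  Hom := PredBox.Hom
  id A := ⟨pid A.carrier, by rw [box_pid]; exact pLe_refl A.pred⟩
  comp f g := ⟨pcomp f.map g.map, by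
    rw [box_pcomp]; exact pLe_trans f.le (box_mono f.map g.le)⟩
  id_comp f := PredBox.Hom.ext (by simp [pcomp, pid, coprod.inl_desc])
  comp_id f := PredBox.Hom.ext (by simp [pcomp, pid, coprod.inl_desc])
  assoc f g h := PredBox.Hom.ext (by simp [pcomp, coprod.inr_desc])

/-- The zero (falsity) functor from partial maps to their category of predicates. -/
def zeroFunctor (C : Type u) [Category.{v} C] [HasFiniteCoproducts C] [HasTerminal C]
    [Effectus C] : Par C ⥤ PredBox C where
  obj X := ⟨X.of, falsity X.of⟩
  map {X Y} f := PredBox.Hom.mk (A := ⟨X.of, falsity X.of⟩) (B := ⟨Y.of, falsity Y.of⟩) f.map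
    (falsity_pLe _)

/-- An effectus in total form has quotients: the zero functor of its category of partial maps
has a left adjoint. -/
def HasQuotients (C : Type u) [Category.{v} C] [HasFiniteCoproducts C] [HasTerminal C]
    [Effectus C] : Prop :=
  (zeroFunctor C).IsRightAdjoint

end

end EffectusTheory

namespace EffectusTheory

variable {C : Type u} [Category.{v} C] [HasFiniteCoproducts C] [HasTerminal C]

attribute [local simp] coprod.inl_desc coprod.inr_desc coprod.inl_desc_assoc coprod.inr_desc_assoc

attribute [-simp] coprod.desc_comp

/-! ### Pullbacks from existence and uniqueness of lifts -/

/-! In an extensive category every map into `X ⨿ Y` is, up to isomorphism, a coproduct of two maps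
(`exists_iso_coprod`). A predicate on `X` is then a decomposition of `X` into the part where it
holds and the part where it fails, and equations may be checked on each part (`hom_ext_of_pred`).
The assert map is the identity on the first part and zero on the second, comprehension is the first
part, and the quotient is the second. Conversely, an assert map below the identity yields a section
`b : X ⟶ X ⨿ X` of the codiagonal whose two partial projections are the assert maps of `p` and
`ortho p`. The Boolean law says that `b` sends `X` to the left only where `p` holds and to the right
only where it fails (`exists_section`). The canonical isomorphisms of comprehension then factor `b`
through `{X|p} ⨿ {X|ortho p}`, and the factor inverts the copairing of the comprehension maps
(`isIso_desc_cmprMap`). So every predicate decomposes its domain, which is the van Kampen property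
of `1 + 1`; this case suffices for extensivity. -/

omit [HasFiniteCoproducts C] [HasTerminal C] in
theorem isPullback_of_exists {P X Y Z : C} {fst : P ⟶ X} {snd : P ⟶ Y} {f : X ⟶ Z} {g : Y ⟶ Z}
    (w : fst ≫ f = snd ≫ g)
    (hex : ∀ {W : C} (a : W ⟶ X) (b : W ⟶ Y), a ≫ f = b ≫ g →
      ∃ l : W ⟶ P, l ≫ fst = a ∧ l ≫ snd = b)
    (huniq : ∀ {W : C} (l l' : W ⟶ P), l ≫ fst = l' ≫ fst → l ≫ snd = l' ≫ snd → l = l') :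
    IsPullback fst snd f g := by
  refine ⟨⟨w⟩, ⟨PullbackCone.IsLimit.mk w (fun s => (hex s.fst s.snd s.condition).choose)
    (fun s => (hex s.fst s.snd s.condition).choose_spec.1)
    (fun s => (hex s.fst s.snd s.condition).choose_spec.2) fun s m h₁ h₂ => ?_⟩⟩
  have h := (hex s.fst s.snd s.condition).choose_spec
  exact huniq _ _ (h₁.trans h.1.symm) (h₂.trans h.2.symm)

omit [HasTerminal C] in
-- Translates the coproduct side of the van Kampen condition into invertibility of a copairing, the
-- form used in both directions of the theorem.
theorem nonempty_isColimit_iff_isIso_desc {X Y : C} (c : BinaryCofan X Y) :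
    Nonempty (IsColimit c) ↔ IsIso (coprod.desc c.inl c.inr) := by
  constructor
  · rintro ⟨h⟩
    have : coprod.desc c.inl c.inr = ((coprodIsCoprod X Y).coconePointUniqueUpToIso h).hom := by
      ext
      · rw [coprod.inl_desc]
        exact ((coprodIsCoprod X Y).comp_coconePointUniqueUpToIso_hom h ⟨.left⟩).symm
      · rw [coprod.inr_desc]
        exact ((coprodIsCoprod X Y).comp_coconePointUniqueUpToIso_hom h ⟨.right⟩).symm
    rw [this]
    exact Iso.isIso_hom _
  · intro h
    exact ⟨(coprodIsCoprod X Y).ofIsoColimit (BinaryCofan.ext (@asIso _ _ _ _ _ h)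
      (coprod.inl_desc c.inl c.inr) (coprod.inr_desc c.inl c.inr))⟩

/-! ### Truth, falsity and orthosupplements. -/

theorem comp_falsity {X Y : C} (f : X ⟶ Y) : f ≫ falsity Y = falsity X := by
  rw [falsity, falsity, ← Category.assoc]
  congr 1
  exact Subsingleton.elim _ _

@[simp]
theorem truth_ortho (X : C) : ortho (truth X) = falsity X := by
  simp [ortho, truth, falsity]

@[simp]
theorem falsity_ortho (X : C) : ortho (falsity X) = truth X := by
  simp [ortho, truth, falsity]

@[simp]
theorem ortho_ortho {X : C} (p : Pred X) : ortho (ortho p) = p := by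
  have : (coprod.desc coprod.inr coprod.inl : (⊤_ C) ⨿ (⊤_ C) ⟶ _) ≫
      coprod.desc coprod.inr coprod.inl = 𝟙 _ := by ext <;> simp
  rw [ortho, ortho, Category.assoc, this, Category.comp_id]

theorem comp_ortho {X Y : C} (f : X ⟶ Y) (p : Pred Y) : f ≫ ortho p = ortho (f ≫ p) := by
  simp [ortho]

theorem inl_map_from (X Y : C) :
    coprod.inl ≫ coprod.map (terminal.from X) (terminal.from Y) = truth X := by
  simp [truth]

theorem braiding_map_from (X Y : C) :
    (coprod.braiding X Y).hom ≫ coprod.map (terminal.from Y) (terminal.from X) =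
      ortho (coprod.map (terminal.from X) (terminal.from Y)) := by
  ext <;> simp [ortho]

/-- A section of the codiagonal gives a partial map below the identity. -/
theorem projOne_pLe_pid {X : C} {b : X ⟶ X ⨿ X} (h : b ≫ codiag X = 𝟙 X) :
    PLe (b ≫ projOne X X) (pid X) :=
  ⟨b ≫ projTwo X X, b ≫ coprod.inl, ⟨by simp [pcomp], by simp [pcomp]⟩, by
    rw [Category.assoc, coprod.inl_map, reassoc_of% h, pid]⟩

theorem kerSupp_comp_projOne {X Y Z : C} (b : X ⟶ Y ⨿ Z) :
    kerSupp (b ≫ projOne Y Z) = b ≫ coprod.map (terminal.from Y) (terminal.from Z) := by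
  rw [kerSupp, projOne, Category.assoc]
  congr 1
  ext <;> simp

theorem projOne_braiding (X : C) : (coprod.braiding X X).hom ≫ projOne X X = projTwo X X := by
  ext <;> simp [projOne, projTwo]

/-- After reassociation `mapIV` only tests membership in the first summand of `1 + (1 + 1)`, so the
pullbacks along coprojections apply to it. -/
theorem mapIV_eq : mapIV C = (coprod.associator _ _ _).hom ≫
    coprod.map (𝟙 (⊤_ C)) (terminal.from ((⊤_ C) ⨿ (⊤_ C))) := by
  rw [Subsingleton.elim (terminal.from ((⊤_ C) ⨿ (⊤_ C))) (codiag _)]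
  ext <;> simp [mapIV]

/-! ### Basic facts about effectuses -/

section Basic

variable [Effectus C]

theorem isPullback_inr (X Y : C) : IsPullback (terminal.from Y) (coprod.inr : Y ⟶ X ⨿ Y)
    (coprod.inr : (⊤_ C) ⟶ _) (coprod.map (terminal.from X) (terminal.from Y)) :=
  (Effectus.isPullback_inl Y X).of_iso (Iso.refl _) (Iso.refl _) (coprod.braiding Y X)
    (coprod.braiding _ _) (by simp) (by simp) (by simp) (by ext <;> simp)

/-- It is a pullback of the coprojection `1 ⟶ 1 + 1`, which is monic because its source is terminal.
-/
instance mono_coprod_inl (X Y : C) : Mono (coprod.inl : X ⟶ X ⨿ Y) := by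
  have : Mono (coprod.inl : (⊤_ C) ⟶ (⊤_ C) ⨿ (⊤_ C)) := ⟨fun _ _ _ => Subsingleton.elim _ _⟩
  exact (MorphismProperty.monomorphisms C).of_isPullback (Effectus.isPullback_inl X Y)
    (.infer_property _)

instance mono_coprod_inr (X Y : C) : Mono (coprod.inr : Y ⟶ X ⨿ Y) := by
  have : Mono (coprod.inr : (⊤_ C) ⟶ (⊤_ C) ⨿ (⊤_ C)) := ⟨fun _ _ _ => Subsingleton.elim _ _⟩
  exact (MorphismProperty.monomorphisms C).of_isPullback (isPullback_inr X Y) (.infer_property _)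

theorem exists_comp_inl_eq {W X Y : C} (f : W ⟶ X ⨿ Y)
    (h : f ≫ coprod.map (terminal.from X) (terminal.from Y) = truth W) :
    ∃ u : W ⟶ X, u ≫ coprod.inl = f :=
  ⟨_, (Effectus.isPullback_inl X Y).lift_snd (terminal.from W) f h.symm⟩

theorem exists_comp_inr_eq {W X Y : C} (f : W ⟶ X ⨿ Y)
    (h : f ≫ coprod.map (terminal.from X) (terminal.from Y) = falsity W) :
    ∃ u : W ⟶ Y, u ≫ coprod.inr = f :=
  ⟨_, (isPullback_inr X Y).lift_snd (terminal.from W) f h.symm⟩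

/-- A partial map with false domain predicate is zero. -/
theorem eq_pzero_of_kerSupp_eq_falsity {X Y : C} (f : PHom X Y) (h : kerSupp f = falsity X) :
    f = pzero X Y := by
  obtain ⟨u, rfl⟩ := exists_comp_inr_eq f (by
    rw [← h, kerSupp, Subsingleton.elim (terminal.from (⊤_ C)) (𝟙 _)])
  rw [pzero, Subsingleton.elim u (terminal.from X)]

/-- A predicate above the true predicate is true. -/
theorem eq_truth_of_truth_pLe {X : C} {q : Pred X} (h : PLe (truth X) q) : q = truth X := by
  obtain ⟨s, hs⟩ := h
  obtain ⟨b, h₁, -, rfl⟩ := (isSum_pred_iff _ _ _).1 hs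
  -- The first component of the bound is true, so the bound lies in the first copy of `1` and is
  -- constant; this determines the sum.
  obtain ⟨u, hu⟩ := exists_comp_inl_eq (b ≫ (coprod.associator _ _ _).hom) (by
    rw [Subsingleton.elim (terminal.from (⊤_ C)) (𝟙 _), Category.assoc, ← mapIV_eq, h₁])
  have hb : b = u ≫ coprod.inl ≫ coprod.inl := by
    rw [← cancel_mono (coprod.associator _ _ _).hom, ← hu]
    simp
  rw [hb, Subsingleton.elim u (terminal.from X)]
  simp [truth]

theorem truth_pLe_iff {X : C} {q : Pred X} : PLe (truth X) q ↔ q = truth X :=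
  ⟨eq_truth_of_truth_pLe, fun h => h ▸ pLe_refl _⟩

/-- A partial map below the identity comes from a section of the codiagonal. -/
theorem exists_section_of_pLe_pid {X : C} {f : PHom X X} (h : PLe f (pid X)) :
    ∃ b : X ⟶ X ⨿ X, b ≫ codiag X = 𝟙 X ∧ b ≫ projOne X X = f := by
  obtain ⟨g, B, ⟨rfl, -⟩, hB⟩ := h
  -- The sum `pid X` is total, so its bound is total too and comes from a map into `X ⨿ X`.
  obtain ⟨b, rfl⟩ := exists_comp_inl_eq B (by
    have : coprod.map (terminal.from (X ⨿ X)) (terminal.from (⊤_ C)) =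
        coprod.map (codiag X) (𝟙 (⊤_ C)) ≫ coprod.map (terminal.from X) (terminal.from _) := by
      ext <;> simp
    rw [this, reassoc_of% hB, pid, inl_map_from])
  refine ⟨b, ?_, by simp [pcomp]⟩
  rw [← cancel_mono (coprod.inl : X ⟶ X ⨿ ⊤_ C)]
  simpa [pid] using hB

/-- Where `kerSupp f` holds, a side-effect free endomap `f` is the identity. -/
theorem comp_eq_pid_of_pLe_pid {W X : C} {f : PHom X X} (hf : PLe f (pid X)) (j : W ⟶ X)
    (hj : j ≫ kerSupp f = truth W) : j ≫ f = j ≫ pid X := by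
  obtain ⟨b, hb, rfl⟩ := exists_section_of_pLe_pid hf
  rw [kerSupp_comp_projOne, ← Category.assoc] at hj
  obtain ⟨u, hu⟩ := exists_comp_inl_eq _ hj
  -- The codiagonal undoes `b`, so it identifies the left component of `j ≫ b`.
  have : u = j := by
    have := congr($hu ≫ codiag X)
    simpa [hb] using this
  rw [reassoc_of% hu.symm, this]
  simp [projOne, pid]

/-- Where `kerSupp f` fails, a partial map `f` is zero. -/
theorem comp_eq_pzero_of_kerSupp {W X Y : C} {f : PHom X Y} (j : W ⟶ X)
    (hj : j ≫ kerSupp f = falsity W) : j ≫ f = pzero W Y :=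
  eq_pzero_of_kerSupp_eq_falsity _ (by rw [← hj]; simp [kerSupp])

end Basic

/-! ### Assert maps and their restrictions. -/

theorem asrt_pLe_pid {X : C} (h : Function.Bijective (kerSuppEnd X)) (p : Pred X) :
    PLe (asrt h p) (pid X) :=
  ((Equiv.ofBijective (kerSuppEnd X) h).symm p).2

@[simp]
theorem kerSupp_asrt {X : C} (h : Function.Bijective (kerSuppEnd X)) (p : Pred X) :
    kerSupp (asrt h p) = p :=
  (Equiv.ofBijective (kerSuppEnd X) h).apply_symm_apply p

theorem eq_asrt {X : C} (h : Function.Bijective (kerSuppEnd X)) {f : PHom X X}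
    (hf : PLe f (pid X)) : f = asrt h (kerSupp f) :=
  congrArg Subtype.val (h.1 (a₁ := ⟨f, hf⟩) (a₂ := ⟨_, asrt_pLe_pid h _⟩)
    (kerSupp_asrt h (kerSupp f)).symm)

theorem comp_asrt_of_truth [Effectus C] {W X : C} (h : Function.Bijective (kerSuppEnd X))
    {p : Pred X} (j : W ⟶ X) (hj : j ≫ p = truth W) : j ≫ asrt h p = j ≫ pid X :=
  comp_eq_pid_of_pLe_pid (asrt_pLe_pid h p) j (by rwa [kerSupp_asrt])

theorem comp_asrt_of_falsity [Effectus C] {W X : C} (h : Function.Bijective (kerSuppEnd X))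
    {p : Pred X} (j : W ⟶ X) (hj : j ≫ p = falsity W) : j ≫ asrt h p = pzero W X :=
  comp_eq_pzero_of_kerSupp j (by rwa [kerSupp_asrt])

theorem comp_pcomp {W X Y Z : C} (j : W ⟶ X) (f : PHom X Y) (g : PHom Y Z) :
    j ≫ pcomp f g = pcomp (j ≫ f) g := by
  simp [pcomp]

theorem pzero_pcomp {X Y Z : C} (g : PHom Y Z) : pcomp (pzero X Y) g = pzero X Z := by
  simp [pcomp, pzero]

theorem pid_pcomp {W X Y : C} (j : W ⟶ X) (g : PHom X Y) : pcomp (j ≫ pid X) g = j ≫ g := by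
  simp [pcomp, pid]

theorem comp_pzero {W X Y : C} (j : W ⟶ X) : j ≫ pzero X Y = pzero W Y := by
  rw [pzero, pzero, ← Category.assoc]
  congr 1
  exact Subsingleton.elim _ _

/-! ### Extensive categories -/

section Extensive

variable [FinitaryExtensive C]

omit [HasTerminal C] in
theorem isPullback_coprod_map {X X' Y Y' : C} (f : X' ⟶ X) (g : Y' ⟶ Y) :
    IsPullback coprod.inl f (coprod.map f g) coprod.inl ∧
      IsPullback coprod.inr g (coprod.map f g) coprod.inr :=
  ((BinaryCofan.isVanKampen_iff _).1 (FinitaryExtensive.vanKampen _ (coprodIsCoprod X Y))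
    (BinaryCofan.mk coprod.inl coprod.inr) f g (coprod.map f g) (coprod.inl_map f g).symm
    (coprod.inr_map f g).symm).1
    ⟨coprodIsCoprod _ _⟩

omit [HasTerminal C] in
theorem exists_of_comp_map_eq_inl {W X X' Y Y' : C} {f : X' ⟶ X} {g : Y' ⟶ Y}
    (h : W ⟶ X' ⨿ Y') (k : W ⟶ X) (w : h ≫ coprod.map f g = k ≫ coprod.inl) :
    ∃ u : W ⟶ X', u ≫ coprod.inl = h ∧ u ≫ f = k :=
  ⟨_, (isPullback_coprod_map f g).1.lift_fst h k w, (isPullback_coprod_map f g).1.lift_snd h k w⟩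

omit [HasTerminal C] in
theorem exists_of_comp_map_eq_inr {W X X' Y Y' : C} {f : X' ⟶ X} {g : Y' ⟶ Y}
    (h : W ⟶ X' ⨿ Y') (k : W ⟶ Y) (w : h ≫ coprod.map f g = k ≫ coprod.inr) :
    ∃ u : W ⟶ Y', u ≫ coprod.inr = h ∧ u ≫ g = k :=
  ⟨_, (isPullback_coprod_map f g).2.lift_fst h k w, (isPullback_coprod_map f g).2.lift_snd h k w⟩

omit [HasTerminal C] in
theorem isIso_desc_of_isPullback {X Y Z Z₁ Z₂ : C} {f : Z ⟶ X ⨿ Y} {i₁ : Z₁ ⟶ Z}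
    {i₂ : Z₂ ⟶ Z} {f₁ : Z₁ ⟶ X} {f₂ : Z₂ ⟶ Y} (h₁ : IsPullback i₁ f₁ f coprod.inl)
    (h₂ : IsPullback i₂ f₂ f coprod.inr) : IsIso (coprod.desc i₁ i₂) :=
  (nonempty_isColimit_iff_isIso_desc (BinaryCofan.mk i₁ i₂)).1
    (((BinaryCofan.isVanKampen_iff _).1 (FinitaryExtensive.vanKampen _ (coprodIsCoprod X Y))
      (BinaryCofan.mk i₁ i₂) f₁ f₂ f h₁.w.symm h₂.w.symm).2 ⟨h₁, h₂⟩)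

omit [HasTerminal C] in
/-- In an extensive category, a map into a coproduct splits as a coproduct of maps. -/
theorem exists_iso_coprod {X Y Z : C} (f : Z ⟶ X ⨿ Y) :
    ∃ (Z₁ Z₂ : C) (e : Z₁ ⨿ Z₂ ≅ Z) (f₁ : Z₁ ⟶ X) (f₂ : Z₂ ⟶ Y),
      e.hom ≫ f = coprod.map f₁ f₂ := by
  have h₁ := IsPullback.of_hasPullback f (coprod.inl : X ⟶ X ⨿ Y)
  have h₂ := IsPullback.of_hasPullback f (coprod.inr : Y ⟶ X ⨿ Y)
  have := isIso_desc_of_isPullback h₁ h₂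
  refine ⟨_, _, asIso (coprod.desc (pullback.fst f coprod.inl) (pullback.fst f coprod.inr)),
    pullback.snd _ _, pullback.snd _ _, ?_⟩
  ext <;> simp [h₁.w, h₂.w]

/-- Two maps out of `X` agree if they agree where a predicate holds and where it fails. -/
theorem hom_ext_of_pred {X Y : C} (p : Pred X) {f g : X ⟶ Y}
    (h₁ : ∀ {W : C} (j : W ⟶ X), j ≫ p = truth W → j ≫ f = j ≫ g)
    (h₂ : ∀ {W : C} (j : W ⟶ X), j ≫ p = falsity W → j ≫ f = j ≫ g) : f = g := by
  obtain ⟨X₁, X₂, e, p₁, p₂, h⟩ := exists_iso_coprod p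
  rw [← cancel_epi e.hom]
  ext
  · have := h₁ (coprod.inl ≫ e.hom) (by
      rw [Category.assoc, h, coprod.inl_map, truth, Subsingleton.elim p₁ (terminal.from _)])
    simpa using this
  · have := h₂ (coprod.inr ≫ e.hom) (by
      rw [Category.assoc, h, coprod.inr_map, falsity, Subsingleton.elim p₂ (terminal.from _)])
    simpa using this

/-- Compatible maps to `X + 1` and `1 + Y` induce one predicate on `W`, hence one decomposition of
`W`. The lift takes its first part from the first map and its second part from the second map; the
remaining components land in `1`. -/
theorem isPullback_projections (X Y : C) : IsPullback
    (coprod.map (𝟙 X) (terminal.from Y)) (coprod.map (terminal.from X) (𝟙 Y))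
    (coprod.map (terminal.from X) (𝟙 (⊤_ C))) (coprod.map (𝟙 (⊤_ C)) (terminal.from Y)) := by
  refine isPullback_of_exists (by ext <;> simp) ?_ ?_
  · intro W a b h
    obtain ⟨W₁, W₂, e, t₁, t₂, ht⟩ := exists_iso_coprod (a ≫ coprod.map (terminal.from X) (𝟙 _))
    obtain ⟨a₁, ha₁, -⟩ := exists_of_comp_map_eq_inl (coprod.inl ≫ e.hom ≫ a) t₁ (by
      simpa using coprod.inl ≫= ht)
    obtain ⟨a₂, ha₂, -⟩ := exists_of_comp_map_eq_inr (coprod.inr ≫ e.hom ≫ a) t₂ (by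
      simpa using coprod.inr ≫= ht)
    rw [h] at ht
    obtain ⟨b₁, hb₁, -⟩ := exists_of_comp_map_eq_inl (coprod.inl ≫ e.hom ≫ b) t₁ (by
      simpa using coprod.inl ≫= ht)
    obtain ⟨b₂, hb₂, -⟩ := exists_of_comp_map_eq_inr (coprod.inr ≫ e.hom ≫ b) t₂ (by
      simpa using coprod.inr ≫= ht)
    refine ⟨e.inv ≫ coprod.map a₁ b₂, ?_, ?_⟩
    · rw [← cancel_epi e.hom]
      ext
      · simp [← ha₁]
      · simp [← ha₂, Subsingleton.elim a₂ (terminal.from _)]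
    · rw [← cancel_epi e.hom]
      ext
      · simp [← hb₁, Subsingleton.elim b₁ (terminal.from _)]
      · simp [← hb₂]
  · intro W l l' h₁ h₂
    obtain ⟨W₁, W₂, e, l₁, l₂, hl⟩ := exists_iso_coprod l
    rw [← cancel_epi e.hom, hl]
    ext
    · obtain ⟨u, hu, hu'⟩ := exists_of_comp_map_eq_inl (f := 𝟙 X) (g := terminal.from Y)
        (coprod.inl ≫ e.hom ≫ l') l₁ (by
          rw [Category.assoc, Category.assoc, ← h₁, reassoc_of% hl]; simp)
      rw [← hu, ← hu']
      simp
    · obtain ⟨u, hu, hu'⟩ := exists_of_comp_map_eq_inr (f := terminal.from X) (g := 𝟙 Y)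
        (coprod.inr ≫ e.hom ≫ l') l₂ (by
          rw [Category.assoc, Category.assoc, ← h₂, reassoc_of% hl]; simp)
      rw [← hu, ← hu']
      simp

/-- `mapIV` detects the first of the three points. Where it is hit, the map is forced; elsewhere the
map lands in the other two points, on which `mapXI` is the identity. -/
theorem mapIV_mapXI_jointly_monic {X : C} (f g : X ⟶ ((⊤_ C) ⨿ (⊤_ C)) ⨿ (⊤_ C))
    (h₁ : f ≫ mapIV C = g ≫ mapIV C) (h₂ : f ≫ mapXI C = g ≫ mapXI C) : f = g := by
  have hXI : coprod.inr ≫ (coprod.associator (⊤_ C) (⊤_ C) (⊤_ C)).inv ≫ mapXI C = 𝟙 _ := by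
    ext <;> simp [mapXI]
  refine hom_ext_of_pred (f ≫ mapIV C) (fun j hj => ?_) (fun j hj => ?_) <;>
  rw [← cancel_mono (coprod.associator _ _ _).hom]
  · obtain ⟨u, hu, -⟩ := exists_of_comp_map_eq_inl (j ≫ f ≫ (coprod.associator _ _ _).hom) _
      (by rw [mapIV_eq] at hj; simpa [truth] using hj)
    rw [h₁] at hj
    obtain ⟨u', hu', -⟩ := exists_of_comp_map_eq_inl (j ≫ g ≫ (coprod.associator _ _ _).hom) _
      (by rw [mapIV_eq] at hj; simpa [truth] using hj)
    rw [Category.assoc, Category.assoc, ← hu, ← hu', Subsingleton.elim u u']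
  · obtain ⟨u, hu, -⟩ := exists_of_comp_map_eq_inr (j ≫ f ≫ (coprod.associator _ _ _).hom) _
      (by rw [mapIV_eq] at hj; simpa [falsity] using hj)
    rw [h₁] at hj
    obtain ⟨u', hu', -⟩ := exists_of_comp_map_eq_inr (j ≫ g ≫ (coprod.associator _ _ _).hom) _
      (by rw [mapIV_eq] at hj; simpa [falsity] using hj)
    have hf : u = j ≫ f ≫ mapXI C := by
      have := hu =≫ ((coprod.associator _ _ _).inv ≫ mapXI C)
      rw [Category.assoc, hXI] at this
      simpa only [Category.assoc, Iso.hom_inv_id_assoc, Category.comp_id] using this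
    have hg : u' = j ≫ g ≫ mapXI C := by
      have := hu' =≫ ((coprod.associator _ _ _).inv ≫ mapXI C)
      rw [Category.assoc, hXI] at this
      simpa only [Category.assoc, Iso.hom_inv_id_assoc, Category.comp_id] using this
    rw [Category.assoc, Category.assoc, ← hu, ← hu', hf, hg, h₂]

instance effectus_of_finitaryExtensive : Effectus C where
  isPullback_map := isPullback_projections
  isPullback_inl _ _ := (isPullback_coprod_map _ _).1.flip
  jointly_monic := mapIV_mapXI_jointly_monic

/-- A side-effect free map is the identity on its domain and zero off it, hence is determined by its
domain. For surjectivity, the two parts of `X` cut out by `p` are sent to different copies in `X ⨿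
X`, and `projOne` keeps the first. -/
theorem bijective_kerSuppEnd (X : C) : Function.Bijective (kerSuppEnd X) := by
  constructor
  · rintro ⟨f, hf⟩ ⟨g, hg⟩ (h : kerSupp f = kerSupp g)
    refine Subtype.ext (hom_ext_of_pred (kerSupp f) (fun j hj => ?_) (fun j hj => ?_))
    · rw [comp_eq_pid_of_pLe_pid hf j hj, comp_eq_pid_of_pLe_pid hg j (h ▸ hj)]
    · rw [comp_eq_pzero_of_kerSupp j hj, comp_eq_pzero_of_kerSupp j (h ▸ hj)]
  · intro p
    obtain ⟨X₁, X₂, e, p₁, p₂, h⟩ := exists_iso_coprod p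
    refine ⟨⟨(e.inv ≫ coprod.map (coprod.inl ≫ e.hom) (coprod.inr ≫ e.hom)) ≫ projOne X X,
      projOne_pLe_pid ?_⟩, ?_⟩
    · rw [← cancel_epi e.hom]
      ext <;> simp
    · change kerSupp _ = p
      rw [kerSupp_comp_projOne, Category.assoc, Iso.inv_comp_eq, h]
      ext
      · simp [Subsingleton.elim p₁ (terminal.from _)]
      · simp [Subsingleton.elim p₂ (terminal.from _)]

instance booleanEffectus_of_finitaryExtensive : BooleanEffectus C where
  bijective_kerSupp := bijective_kerSuppEnd
  asrt_comm X p q := by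
    -- On each of the four parts cut out by `p` and `q`, each assert map is the inclusion or zero.
    refine hom_ext_of_pred p (fun j hj => ?_) (fun j hj => ?_) <;>
    refine hom_ext_of_pred (j ≫ q) (fun k hk => ?_) (fun k hk => ?_) <;>
    rw [← Category.assoc] at hk
    · have hj' : (k ≫ j) ≫ p = truth _ := by rw [Category.assoc, hj, comp_truth]
      rw [← Category.assoc, ← Category.assoc, comp_pcomp, comp_pcomp]
      simp only [comp_asrt_of_truth _ _ hj', comp_asrt_of_truth _ _ hk, pid_pcomp]
    · have hj' : (k ≫ j) ≫ p = truth _ := by rw [Category.assoc, hj, comp_truth]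
      rw [← Category.assoc, ← Category.assoc, comp_pcomp, comp_pcomp]
      simp only [comp_asrt_of_truth _ _ hj', comp_asrt_of_falsity _ _ hk, pid_pcomp, pzero_pcomp]
    · have hj' : (k ≫ j) ≫ p = falsity _ := by rw [Category.assoc, hj, comp_falsity]
      rw [← Category.assoc, ← Category.assoc, comp_pcomp, comp_pcomp]
      simp only [comp_asrt_of_falsity _ _ hj', comp_asrt_of_truth _ _ hk, pid_pcomp, pzero_pcomp]
    · have hj' : (k ≫ j) ≫ p = falsity _ := by rw [Category.assoc, hj, comp_falsity]
      rw [← Category.assoc, ← Category.assoc, comp_pcomp, comp_pcomp]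
      simp only [comp_asrt_of_falsity _ _ hj', comp_asrt_of_falsity _ _ hk, pzero_pcomp]
  asrt_ortho X p := by
    refine hom_ext_of_pred p (fun j hj => ?_) (fun j hj => ?_) <;>
    rw [comp_pcomp, comp_pzero]
    · rw [comp_asrt_of_falsity _ j (by rw [comp_ortho, hj, truth_ortho]), pzero_pcomp]
    · rw [comp_asrt_of_truth _ j (by rw [comp_ortho, hj, falsity_ortho]), pid_pcomp,
        comp_asrt_of_falsity _ j hj]

end Extensive

/-! ### Comprehension in an effectus -/

section Comprehension

variable [Effectus C] {G : PredCat C ⥤ C} (adj : truthFunctor C ⊣ G)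

theorem truthHom_comp_pred {X : C} {A : PredCat C} (f : (truthFunctor C).obj X ⟶ A) :
    PredCat.Hom.map f ≫ A.pred = truth X :=
  eq_truth_of_truth_pLe (PredCat.Hom.le f)

theorem cmprMap_comp_pred (A : PredCat C) : cmprMap adj A ≫ A.pred = truth _ :=
  truthHom_comp_pred (adj.counit.app A)

theorem homEquiv_comp_cmprMap {X : C} {A : PredCat C} (f : (truthFunctor C).obj X ⟶ A) :
    adj.homEquiv X A f ≫ cmprMap adj A = f.map := by
  have := (adj.homEquiv X A).symm_apply_apply f
  rw [Adjunction.homEquiv_counit] at this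
  exact congrArg PredCat.Hom.map this

theorem homEquiv_symm_map {X : C} {A : PredCat C} (g : X ⟶ G.obj A) :
    ((adj.homEquiv X A).symm g).map = g ≫ cmprMap adj A := by
  rw [Adjunction.homEquiv_counit]
  rfl

/-- The comprehension map of a predicate is the pullback of truth. -/
theorem isPullback_cmprMap (A : PredCat C) :
    IsPullback (cmprMap adj A) (terminal.from _) A.pred (coprod.inl : (⊤_ C) ⟶ _) := by
  refine isPullback_of_exists (cmprMap_comp_pred adj A) ?_ ?_
  · intro W a b h
    rw [Subsingleton.elim b (terminal.from _)] at h
    exact ⟨adj.homEquiv W A (PredCat.Hom.mk a (truth_pLe_iff.2 h)), homEquiv_comp_cmprMap adj _,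
      Subsingleton.elim _ _⟩
  · intro W l l' h _
    refine (adj.homEquiv W A).symm.injective (PredCat.Hom.ext ?_)
    rw [homEquiv_symm_map, homEquiv_symm_map, h]

/-- The comprehension map of `ortho p` is the pullback of falsity along `p`. -/
theorem isPullback_cmprMap_ortho {X : C} (p : Pred X) :
    IsPullback (cmprMap adj ⟨X, ortho p⟩) (terminal.from _) p (coprod.inr : (⊤_ C) ⟶ _) :=
  (isPullback_cmprMap adj ⟨X, ortho p⟩).of_iso (Iso.refl _) (Iso.refl _) (Iso.refl _)
    (coprod.braiding _ _) (by simp) (by simp)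
    (by
      change ortho p ≫ coprod.desc coprod.inr coprod.inl = 𝟙 X ≫ p
      rw [Category.id_comp]
      exact ortho_ortho p)
    (by simp)

theorem mono_cmprMap (A : PredCat C) : Mono (cmprMap adj A) := by
  have : Mono (coprod.inl : (⊤_ C) ⟶ (⊤_ C) ⨿ (⊤_ C)) := inferInstance
  exact (MorphismProperty.monomorphisms C).of_isPullback (isPullback_cmprMap adj A).flip this

theorem cmprCanonical_comp_cmprMap {X : C} (p : Pred X) (Y : C) :
    cmprCanonical adj p Y ≫ cmprMap adj ⟨X ⨿ Y, coprod.desc p (truth Y)⟩ =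
      coprod.map (cmprMap adj ⟨X, p⟩) (𝟙 Y) :=
  homEquiv_comp_cmprMap adj (cmprSumHom adj p Y)

theorem hasPullbacksOfInclusions (adj : truthFunctor C ⊣ G) : HasPullbacksOfInclusions C where
  hasPullbackInl {X Y Z} f := by
    let p : Pred Z := f ≫ coprod.map (terminal.from X) (terminal.from Y)
    have hp : IsPullback _ _ p _ := isPullback_cmprMap adj ⟨Z, p⟩
    obtain ⟨u, hu⟩ := exists_comp_inl_eq (cmprMap adj ⟨Z, p⟩ ≫ f) (by
      rw [Category.assoc]; exact hp.w)
    have h : IsPullback (cmprMap adj ⟨Z, p⟩) u f coprod.inl := by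
      -- Comprehension gives the pullback of `1 ⟶ 1 + 1`; cancelling the effectus square below it
      -- leaves the pullback of `X ⟶ X ⨿ Y`.
      refine IsPullback.of_bot ?_ hu.symm (Effectus.isPullback_inl X Y).flip
      rwa [Subsingleton.elim (u ≫ terminal.from X) (terminal.from _)]
    exact ⟨⟨⟨_, h.flip.isLimit⟩⟩⟩

variable (hG : ∀ (X : C) (p : Pred X) (Y : C), IsIso (cmprCanonical adj p Y))

include hG in
/-- A map into `X + Y` with values where `p` holds or in `Y` factors through `{X | p} + Y`. -/
theorem exists_comp_map_cmprMap_eq {W X Y : C} {p : Pred X} (b : W ⟶ X ⨿ Y)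
    (h : b ≫ coprod.desc p (truth Y) = truth W) :
    ∃ c, c ≫ coprod.map (cmprMap adj ⟨X, p⟩) (𝟙 Y) = b := by
  have := hG X p Y
  have hP := isPullback_cmprMap adj ⟨X ⨿ Y, coprod.desc p (truth Y)⟩
  refine ⟨hP.lift b (terminal.from W) h ≫ inv (cmprCanonical adj p Y), ?_⟩
  rw [← cmprCanonical_comp_cmprMap, Category.assoc, IsIso.inv_hom_id_assoc]
  exact hP.lift_fst _ _ _

include hG in
-- The one-sided factorization is applied to each summand in turn, with the braiding bringing `Y` to
-- the front.
theorem exists_comp_map_cmprMap_cmprMap_eq {W X Y : C} {p : Pred X} {q : Pred Y} (b : W ⟶ X ⨿ Y)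
    (h₁ : b ≫ coprod.desc p (truth Y) = truth W) (h₂ : b ≫ coprod.desc (truth X) q = truth W) :
    ∃ c, c ≫ coprod.map (cmprMap adj ⟨X, p⟩) (cmprMap adj ⟨Y, q⟩) = b := by
  obtain ⟨c, rfl⟩ := exists_comp_map_cmprMap_eq adj hG b h₁
  obtain ⟨d, hd⟩ := exists_comp_map_cmprMap_eq adj hG (p := q) (c ≫ (coprod.braiding _ _).hom) (by
    rw [← h₂, Category.assoc, Category.assoc]
    congr 1
    ext <;> simp [comp_truth])
  refine ⟨d ≫ (coprod.braiding _ _).inv, ?_⟩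
  have : c = d ≫ coprod.map (cmprMap adj ⟨Y, q⟩) (𝟙 _) ≫ (coprod.braiding _ _).inv := by
    rw [reassoc_of% hd, Iso.hom_inv_id, Category.comp_id]
  rw [this, Category.assoc, Category.assoc, Category.assoc]
  congr 1
  ext <;> simp

end Comprehension

/-- Shows that a morphism from `(X, p)` to `(Y, falsity Y)` is a partial map undefined where `p`
holds. -/
theorem box_falsity {X Y : C} (f : PHom X Y) : box f (falsity Y) = ortho (kerSupp f) := by
  rw [box, kerSupp, ortho, Category.assoc]
  congr 1
  refine coprod.hom_ext ?_ ?_ <;> simp [falsity]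

/-! ### Comprehension in extensive categories. -/

section Extensive

variable [FinitaryExtensive C]

/-- The subobject where a predicate holds. -/
noncomputable def truePart (A : PredCat C) : C := pullback A.pred (coprod.inl : (⊤_ C) ⟶ _)

/-- The inclusion of the subobject where a predicate holds. -/
noncomputable def trueIncl (A : PredCat C) : truePart A ⟶ A.carrier := pullback.fst _ _

theorem isPullback_trueIncl (A : PredCat C) :
    IsPullback (trueIncl A) (terminal.from _) A.pred (coprod.inl : (⊤_ C) ⟶ _) := by
  have := IsPullback.of_hasPullback A.pred (coprod.inl : (⊤_ C) ⟶ _)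
  rwa [Subsingleton.elim (pullback.snd A.pred coprod.inl) (terminal.from _)] at this

theorem trueIncl_comp_pred (A : PredCat C) : trueIncl A ≫ A.pred = truth _ :=
  (isPullback_trueIncl A).w

instance mono_trueIncl (A : PredCat C) : Mono (trueIncl A) := by
  have : Mono (coprod.inl : (⊤_ C) ⟶ (⊤_ C) ⨿ (⊤_ C)) := inferInstance
  exact (MorphismProperty.monomorphisms C).of_isPullback (isPullback_trueIncl A).flip this

/-- Maps from `(X, 1)` to `(Y, q)` correspond to maps from `X` to the subobject where `q` holds. -/
noncomputable def truthHomEquiv (X : C) (A : PredCat C) :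
    ((truthFunctor C).obj X ⟶ A) ≃ (X ⟶ truePart A) where
  toFun f := (isPullback_trueIncl A).lift (PredCat.Hom.map f) (terminal.from X)
    (truthHom_comp_pred f)
  invFun g := PredCat.Hom.mk (A := ⟨X, truth X⟩) (g ≫ trueIncl A) (truth_pLe_iff.2 (by
    rw [Category.assoc, trueIncl_comp_pred, comp_truth]))
  left_inv f := PredCat.Hom.ext ((isPullback_trueIncl A).lift_fst _ _ _)
  right_inv g := by
    rw [← cancel_mono (trueIncl A)]
    exact (isPullback_trueIncl A).lift_fst _ _ _

theorem truthHomEquiv_comp_trueIncl {X : C} {A : PredCat C} (f : (truthFunctor C).obj X ⟶ A) :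
    truthHomEquiv X A f ≫ trueIncl A = PredCat.Hom.map f :=
  (isPullback_trueIncl A).lift_fst _ _ _

theorem truthHomEquiv_naturality {X' X : C} {A : PredCat C} (f : X' ⟶ X)
    (g : (truthFunctor C).obj X ⟶ A) :
    truthHomEquiv X' A ((truthFunctor C).map f ≫ g) = f ≫ truthHomEquiv X A g := by
  rw [← cancel_mono (trueIncl A), Category.assoc, truthHomEquiv_comp_trueIncl,
    truthHomEquiv_comp_trueIncl]
  rfl

/-- Pulling the comprehension map of `[p, 1]` back along the two coprojections of `X ⨿ Y` gives
`{X|p}` and `Y`, so extensivity makes its domain their coproduct. -/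
theorem isIso_cmprCanonical {G : PredCat C ⥤ C} (adj : truthFunctor C ⊣ G) {X : C} (p : Pred X)
    (Y : C) : IsIso (cmprCanonical adj p Y) := by
  have hc := cmprCanonical_comp_cmprMap adj p Y
  have hA := (isPullback_cmprMap adj ⟨X, p⟩).flip
  have hB := (isPullback_cmprMap adj ⟨X ⨿ Y, coprod.desc p (truth Y)⟩).flip
  have h₁ : IsPullback (coprod.inl ≫ cmprCanonical adj p Y) (cmprMap adj ⟨X, p⟩)
      (cmprMap adj ⟨X ⨿ Y, coprod.desc p (truth Y)⟩) coprod.inl := by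
    refine (IsPullback.of_right ?_ (by rw [Category.assoc, hc, coprod.inl_map]) hB)
    rwa [Subsingleton.elim (_ ≫ terminal.from _) (terminal.from _), coprod.inl_desc]
  have h₂ : IsPullback (coprod.inr ≫ cmprCanonical adj p Y) (𝟙 Y)
      (cmprMap adj ⟨X ⨿ Y, coprod.desc p (truth Y)⟩) coprod.inr := by
    refine IsPullback.of_right ?_ (by rw [Category.assoc, hc, coprod.inr_map]) hB
    refine isPullback_of_exists ?_ ?_ ?_
    · simp [truth]
    · intro W a b h
      exact ⟨b, Subsingleton.elim _ _, Category.comp_id b⟩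
    · intro W l l' _ h
      simpa using h
  have := isIso_desc_of_isPullback h₁ h₂
  have e : coprod.desc (coprod.inl ≫ cmprCanonical adj p Y) (coprod.inr ≫ cmprCanonical adj p Y) =
      cmprCanonical adj p Y := by ext <;> simp
  rwa [e] at this

theorem hasComprehension_of_finitaryExtensive : HasComprehension C :=
  ⟨_, Adjunction.adjunctionOfEquivRight truthHomEquiv
    fun _ _ _ f g => truthHomEquiv_naturality f g, fun _ p Y => isIso_cmprCanonical _ p Y⟩

/-! ### Quotients in extensive categories -/

/-- The subobject where a predicate fails. -/
noncomputable def falsePart (A : PredBox C) : C := pullback A.pred (coprod.inr : (⊤_ C) ⟶ _)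

/-- The inclusion of the subobject where a predicate fails. -/
noncomputable def falseIncl (A : PredBox C) : falsePart A ⟶ A.carrier := pullback.fst _ _

theorem exists_falsePart_iso (A : PredBox C) : ∃ (X₁ : C) (e : X₁ ⨿ falsePart A ≅ A.carrier),
    e.hom ≫ A.pred = coprod.desc (truth X₁) (falsity _) ∧ coprod.inr ≫ e.hom = falseIncl A := by
  have h₁ := IsPullback.of_hasPullback A.pred (coprod.inl : (⊤_ C) ⟶ _)
  have h₂ : IsPullback (falseIncl A) _ _ _ :=
    IsPullback.of_hasPullback A.pred (coprod.inr : (⊤_ C) ⟶ _)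
  rw [Subsingleton.elim (pullback.snd A.pred _) (terminal.from _)] at h₁ h₂
  have := isIso_desc_of_isPullback h₁ h₂
  refine ⟨_, @asIso _ _ _ _ _ this, ?_, ?_⟩
  · refine coprod.hom_ext ?_ ?_
    · simp [h₁.w, truth]
    · rw [coprod.inr_desc, asIso_hom, coprod.inr_desc_assoc]
      exact h₂.w
  · simp

theorem eq_pzero_of_pLe_box_falsity {X Y : C} {p : Pred X} {f : PHom X Y}
    (h : PLe p (box f (falsity Y))) {W : C} (j : W ⟶ X) (hj : j ≫ p = truth W) :
    j ≫ f = pzero W Y := by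
  have h := pLe_precomp j h
  rw [hj] at h
  refine comp_eq_pzero_of_kerSupp j ?_
  rw [← ortho_ortho (kerSupp f), comp_ortho, ← box_falsity, eq_truth_of_truth_pLe h, truth_ortho]

/-- Restricting a map `(X, p) ⟶ (Y, 0)` to the subobject where `p` fails. -/
noncomputable def restrictFalse (A : PredBox C) (Y : Par C) (f : A ⟶ (zeroFunctor C).obj Y) :
    (⟨falsePart A⟩ : Par C) ⟶ Y :=
  Par.Hom.mk (X := ⟨falsePart A⟩) (falseIncl A ≫ PredBox.Hom.map f)

/-- The maps in question vanish where the predicate holds, so restriction to the complement loses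
nothing, and extension by zero inverts it. -/
theorem bijective_restrictFalse (A : PredBox C) (Y : Par C) :
    Function.Bijective (restrictFalse A Y) := by
  obtain ⟨X₁, e, he, hr⟩ := exists_falsePart_iso A
  have he₁ : (coprod.inl ≫ e.hom) ≫ A.pred = truth X₁ := by
    rw [Category.assoc, he, coprod.inl_desc]
  constructor
  · rintro ⟨f : PHom A.carrier Y.of, hf : PLe A.pred (box f (falsity Y.of))⟩
      ⟨g : PHom A.carrier Y.of, hg : PLe A.pred (box g (falsity Y.of))⟩ h
    have h : falseIncl A ≫ f = falseIncl A ≫ g := congrArg Par.Hom.map h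
    refine PredBox.Hom.ext (?_ : f = g)
    rw [← cancel_epi e.hom]
    refine coprod.hom_ext ?_ ?_
    · have := (eq_pzero_of_pLe_box_falsity hf _ he₁).trans
        (eq_pzero_of_pLe_box_falsity hg _ he₁).symm
      simpa only [Category.assoc] using this
    · rw [reassoc_of% hr, reassoc_of% hr, h]
  · rintro ⟨g : PHom (falsePart A) Y.of⟩
    refine ⟨PredBox.Hom.mk (B := ⟨Y.of, falsity Y.of⟩)
      (e.inv ≫ coprod.desc (pzero X₁ Y.of) g) ?_, Par.Hom.ext ?_⟩
    · have hA : A.pred = e.inv ≫ coprod.desc (truth X₁) (falsity _) := by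
        rw [← he, Iso.inv_hom_id_assoc]
      have h₀ : pzero X₁ Y.of ≫ coprod.desc (falsity Y.of) coprod.inl = truth X₁ := by
        simp [pzero, truth]
      rw [hA, box, Category.assoc, coprod.desc_comp, h₀]
      exact pLe_precomp _ (pLe_desc (pLe_refl _) (falsity_pLe _))
    · change falseIncl A ≫ e.inv ≫ coprod.desc (pzero X₁ Y.of) g = g
      rw [← hr, Category.assoc, Iso.hom_inv_id_assoc, coprod.inr_desc]

theorem hasQuotients_of_finitaryExtensive : HasQuotients C :=
  ⟨_, ⟨Adjunction.adjunctionOfEquivLeft (F_obj := fun A => (⟨falsePart A⟩ : Par C))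
    (fun A Y => (Equiv.ofBijective _ (bijective_restrictFalse A Y)).symm) (by
      intro A Y Y' g h
      obtain ⟨f, rfl⟩ := (Equiv.ofBijective _ (bijective_restrictFalse A Y)).surjective h
      rw [Equiv.symm_apply_eq, Equiv.symm_apply_apply]
      exact Par.Hom.ext (comp_pcomp _ (PredBox.Hom.map f) g.map).symm)⟩⟩

end Extensive

/-! ### Boolean effectuses with comprehension are extensive -/

section Boolean

variable [BooleanEffectus C]

/-- In a Boolean effectus every predicate comes from a section of the codiagonal that sends the
part where the predicate holds into the first summand, and the rest into the second. -/
theorem exists_section {X : C} (p : Pred X) : ∃ b : X ⟶ X ⨿ X, b ≫ codiag X = 𝟙 X ∧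
    b ≫ coprod.map (terminal.from X) (terminal.from X) = p ∧
    b ≫ coprod.desc p (truth X) = truth X ∧ b ≫ coprod.desc (truth X) (ortho p) = truth X := by
  have hbij := CommutativeEffectus.bijective_kerSupp X
  obtain ⟨b, hb, hbp⟩ := exists_section_of_pLe_pid (asrt_pLe_pid hbij p)
  have hker : b ≫ coprod.map (terminal.from X) (terminal.from X) = p := by
    rw [← kerSupp_comp_projOne, hbp, kerSupp_asrt]
  -- The swapped section is again a section of the codiagonal, so its first projection is
  -- side-effect free with domain `ortho p`; uniqueness makes it the assert map.
  have hbp' : b ≫ projTwo X X = asrt hbij (ortho p) := by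
    have h : PLe ((b ≫ (coprod.braiding X X).hom) ≫ projOne X X) (pid X) :=
      projOne_pLe_pid (by
        have : (coprod.braiding X X).hom ≫ codiag X = codiag X := by ext <;> simp
        rw [Category.assoc, this, hb])
    have e := eq_asrt hbij h
    rwa [kerSupp_comp_projOne, Category.assoc, Category.assoc, projOne_braiding,
      braiding_map_from, comp_ortho, hker] at e
  -- The domain predicate of the Boolean law: `q` never holds after asserting `ortho q`. It is used
  -- below for `ortho p` and for `p`.
  have key : ∀ q : Pred X, asrt hbij (ortho q) ≫ coprod.desc q coprod.inr = falsity X := by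
    intro q
    have h := BooleanEffectus.asrt_ortho X q
    have h' : kerSupp (pcomp (asrt hbij (ortho q)) (asrt hbij q)) =
        asrt hbij (ortho q) ≫ coprod.desc q coprod.inr := by
      rw [pcomp, kerSupp, Category.assoc]
      congr 1
      refine coprod.hom_ext ?_ ?_
      · rw [coprod.inl_desc_assoc, coprod.inl_desc]
        exact kerSupp_asrt hbij q
      · simp
    rw [← h', h]
    simp [kerSupp, pzero, falsity]
  refine ⟨b, hb, hker, ?_, ?_⟩
  · have h := key (ortho p)
    rw [ortho_ortho, ← hbp, Category.assoc] at h
    have e : projOne X X ≫ coprod.desc (ortho p) coprod.inr = ortho (coprod.desc p (truth X)) := by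
      ext <;> simp [projOne, ortho, truth]
    rw [← ortho_ortho (coprod.desc p _), comp_ortho, ← e, h, falsity_ortho]
  · have h := key p
    rw [← hbp', Category.assoc] at h
    have e : projTwo X X ≫ coprod.desc p coprod.inr =
        ortho (coprod.desc (truth X) (ortho p)) := by
      refine coprod.hom_ext ?_ ?_
      · simp [projTwo, ortho, truth]
      · rw [comp_ortho, coprod.inr_desc, ortho_ortho]
        simp [projTwo]
    rw [← ortho_ortho (coprod.desc _ _), comp_ortho, ← e, h, falsity_ortho]

/-- The factor `c` of the section `b` is a right inverse's candidate on both sides: followed by the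
copairing it is the identity because `b` is a section, while each comprehension map followed by `c`
stays in its own summand, where monicity forces the coprojection. -/
theorem isIso_desc_cmprMap {G : PredCat C ⥤ C} (adj : truthFunctor C ⊣ G)
    (hG : ∀ (X : C) (p : Pred X) (Y : C), IsIso (cmprCanonical adj p Y)) {X : C} (p : Pred X) :
    IsIso (coprod.desc (cmprMap adj ⟨X, p⟩) (cmprMap adj ⟨X, ortho p⟩)) := by
  have := mono_cmprMap adj ⟨X, p⟩
  have := mono_cmprMap adj ⟨X, ortho p⟩
  obtain ⟨b, hb, hp, h₁, h₂⟩ := exists_section p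
  obtain ⟨c, rfl⟩ := exists_comp_map_cmprMap_cmprMap_eq adj hG b h₁ h₂
  have hc : c ≫ coprod.desc (cmprMap adj ⟨X, p⟩) (cmprMap adj ⟨X, ortho p⟩) = 𝟙 X := by
    rw [← hb, Category.assoc]
    congr 1
    ext <;> simp
  have hcp : c ≫ coprod.map (terminal.from _) (terminal.from _) = p := by
    conv_rhs => rw [← hp]
    rw [Category.assoc]
    congr 1
    ext <;> simp
  refine ⟨c, ?_, hc⟩
  ext
  · have hπ : cmprMap adj ⟨X, p⟩ ≫ p = truth _ := cmprMap_comp_pred adj ⟨X, p⟩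
    obtain ⟨u, hu⟩ := exists_comp_inl_eq (cmprMap adj ⟨X, p⟩ ≫ c) (by
      rw [Category.assoc, hcp, hπ])
    have hu' : u ≫ cmprMap adj ⟨X, p⟩ = cmprMap adj ⟨X, p⟩ := by
      have := hu =≫ coprod.desc (cmprMap adj ⟨X, p⟩) (cmprMap adj ⟨X, ortho p⟩)
      rwa [Category.assoc, Category.assoc, hc, coprod.inl_desc, Category.comp_id] at this
    have : u = 𝟙 _ := by
      rw [← cancel_mono (cmprMap adj ⟨X, p⟩), hu', Category.id_comp]
    rw [coprod.inl_desc_assoc, ← hu, this, Category.id_comp, Category.comp_id]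
  · have hπ : cmprMap adj ⟨X, ortho p⟩ ≫ ortho p = truth _ := cmprMap_comp_pred adj ⟨X, ortho p⟩
    obtain ⟨u, hu⟩ := exists_comp_inr_eq (cmprMap adj ⟨X, ortho p⟩ ≫ c) (by
      rw [Category.assoc, hcp, ← truth_ortho, ← hπ, comp_ortho, ortho_ortho])
    have hu' : u ≫ cmprMap adj ⟨X, ortho p⟩ = cmprMap adj ⟨X, ortho p⟩ := by
      have := hu =≫ coprod.desc (cmprMap adj ⟨X, p⟩) (cmprMap adj ⟨X, ortho p⟩)
      rwa [Category.assoc, Category.assoc, hc, coprod.inr_desc, Category.comp_id] at this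
    have : u = 𝟙 _ := by
      rw [← cancel_mono (cmprMap adj ⟨X, ortho p⟩), hu', Category.id_comp]
    rw [coprod.inr_desc_assoc, ← hu, this, Category.id_comp, Category.comp_id]

/-- Forwards, the effectus squares for `X ⨿ Y` are transported along the isomorphism. Backwards,
pullbacks are unique, so `X` and `Y` are the comprehensions of `p` and `ortho p`, which decompose
`Z`. -/
theorem isIso_desc_iff_isPullback {G : PredCat C ⥤ C} (adj : truthFunctor C ⊣ G)
    (hG : ∀ (X : C) (p : Pred X) (Y : C), IsIso (cmprCanonical adj p Y)) {X Y Z : C} {i₁ : X ⟶ Z}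
    {i₂ : Y ⟶ Z} {p : Pred Z} (w₁ : i₁ ≫ p = truth X) (w₂ : i₂ ≫ p = falsity Y) :
    IsIso (coprod.desc i₁ i₂) ↔ IsPullback i₁ (terminal.from X) p coprod.inl ∧
      IsPullback i₂ (terminal.from Y) p coprod.inr := by
  constructor
  · intro h
    let e := asIso (coprod.desc i₁ i₂)
    have ep : e.hom ≫ p = coprod.map (terminal.from X) (terminal.from Y) := by
      refine coprod.hom_ext ?_ ?_
      · simpa [e, truth] using w₁
      · simpa [e, falsity] using w₂
    exact ⟨(Effectus.isPullback_inl X Y).flip.of_iso (Iso.refl _) e (Iso.refl _) (Iso.refl _)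
      (by simp [e]) (by simp) (by simp [ep]) (by simp),
      (isPullback_inr X Y).flip.of_iso (Iso.refl _) e (Iso.refl _) (Iso.refl _)
      (by simp [e]) (by simp) (by simp [ep]) (by simp)⟩
  · rintro ⟨h₁, h₂⟩
    have hp := isIso_desc_cmprMap adj hG p
    have h₁' := isPullback_cmprMap adj ⟨Z, p⟩
    have h₂' := isPullback_cmprMap_ortho adj p
    have e : coprod.desc i₁ i₂ = coprod.map (h₁.isoIsPullback _ _ h₁').hom
        (h₂.isoIsPullback _ _ h₂').hom ≫
          coprod.desc (cmprMap adj ⟨Z, p⟩) (cmprMap adj ⟨Z, ortho p⟩) := by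
      ext <;> simp
    rw [e]
    infer_instance

theorem finitaryExtensive_of_booleanEffectus (h : HasComprehension C) : FinitaryExtensive C := by
  obtain ⟨G, adj, hG⟩ := h
  have := hasPullbacksOfInclusions adj
  -- Given pullbacks along coprojections, it suffices that the single coproduct `1 + 1` is van
  -- Kampen.
  rw [finitaryExtensive_iff_of_isTerminal C (⊤_ C) terminalIsTerminal _ (coprodIsCoprod _ _),
    BinaryCofan.isVanKampen_iff]
  intro X Y c α β p hα hβ
  obtain rfl : α = terminal.from X := Subsingleton.elim _ _
  obtain rfl : β = terminal.from Y := Subsingleton.elim _ _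
  exact (nonempty_isColimit_iff_isIso_desc c).trans
    (isIso_desc_iff_isPullback adj hG hα.symm hβ.symm)

end Boolean

end EffectusTheory

theorem mainTheorem4 {C : Type u} [Category.{v} C] [HasFiniteCoproducts C] [HasTerminal C] :
    (FinitaryExtensive C ↔
      ∃ _ : EffectusTheory.BooleanEffectus C, EffectusTheory.HasComprehension C) ∧
    (FinitaryExtensive C → ∃ _ : EffectusTheory.Effectus C, EffectusTheory.HasQuotients C) := by
  refine ⟨⟨fun _ => ⟨inferInstance, EffectusTheory.hasComprehension_of_finitaryExtensive⟩, ?_⟩,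
    fun _ => ⟨inferInstance, EffectusTheory.hasQuotients_of_finitaryExtensive⟩⟩
  rintro ⟨_, h⟩
  exact EffectusTheory.finitaryExtensive_of_booleanEffectus h
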